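/- Let $\mathbb D=\{z\in\mathbb C:|z|<1\}$, $\mathbb T=\partial\mathbb D$, and $\mathbb Z_+=\{0,1,2,\dots\}$. Let $H^\infty$ be the space of bounded holomorphic functions on $\mathbb D$, each identified with its boundary trace on $\mathbb T$, which is defined almost everywhere by nontangential limits. For an integrable function $f$ on $\mathbb T$ put $\widehat f(k)=\frac1{2\pi}\int_{\mathbb T}\overline\zeta^{\,k}f(\zeta)\,|d\zeta|$ for $k\in\mathbb Z$, and $\operatorname{spec}f=\{k\in\mathbb Z:\widehat f(k)\neq0\}$. For $\Lambda\subset\mathbb Z_+$ let $H^\infty(\Lambda)=\{f\in H^\infty:\operatorname{spec}f\subset\Lambda\}$ and $C_A(\Lambda)=H^\infty(\Lambda)\cap C(\mathbb T)$, the latter endowed with the supremum norm $\|\cdot\|_\infty$. Suppose that $\mathbb Z_+\setminus\Lambda$ is finite. Then the extreme points of the closed unit ball $\{f\in C_A(\Lambda):\|f\|_\infty\le1\}$ are precisely the functions $f\in C_A(\Lambda)$ such that $\|f\|_\infty=1$ and $$\int_{\mathbb T}\log\bigl(1-|f(\zeta)|\bigr)\,|d\zeta|=-\infty,$$ where $\log0=-\infty$.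 -/

import Mathlib

open MeasureTheory Set Filter Topology
open scoped ComplexConjugate ENNReal

noncomputable section

namespace DiskAlgebra

/-- The circle carries its Borel sigma-algebra. -/
instance circleMeasurableSpace : MeasurableSpace Circle := borel Circle

instance circleBorelSpace : BorelSpace Circle := ⟨rfl⟩

/-- Arc length `|dζ|` on the unit circle `𝕋` (total mass `2π`). -/
def arcLength : Measure Circle :=
  (volume.restrict (Ioc (-Real.pi) Real.pi)).map Circle.exp

instance isFiniteMeasure_arcLength : IsFiniteMeasure arcLength := by
  unfold arcLength
  infer_instance

/-- The Fourier coefficient `(1 / 2π) ∫_𝕋 conj(ζ)^k f(ζ) |dζ|` of a function on the circle. -/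
def fourierCoefficient (f : Circle → ℂ) (k : ℤ) : ℂ :=
  (1 / (2 * Real.pi) : ℂ) * ∫ ζ : Circle, (conj (ζ : ℂ)) ^ k * f ζ ∂arcLength

/-- The spectrum of a function on the circle: `{k ∈ ℤ : f̂(k) ≠ 0}`. -/
def spec (f : Circle → ℂ) : Set ℤ := {k | fourierCoefficient f k ≠ 0}

/-- The nontangential approach region (Stolz angle) of aperture `α` at a point `ζ` of the circle. -/
def stolzRegion (α : ℝ) (ζ : Circle) : Set ℂ :=
  {z | ‖z‖ < 1 ∧ ‖z - ζ‖ < α * (1 - ‖z‖)}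

/-- `f` is the boundary trace of `F`: at almost every point `ζ` of the circle, `F(z) → f(ζ)` as
`z → ζ` nontangentially. -/
def IsBoundaryTrace (F : ℂ → ℂ) (f : Circle → ℂ) : Prop :=
  ∀ᵐ ζ : Circle ∂arcLength, ∀ α : ℝ, 1 < α → Tendsto F (𝓝[stolzRegion α ζ] (ζ : ℂ)) (𝓝 (f ζ))

/-- `f`, as a function on the circle, belongs to `H^∞`: it is the boundary trace of a bounded
holomorphic function on the open unit disk. -/
def MemHInfty (f : Circle → ℂ) : Prop :=
  ∃ F : ℂ → ℂ, DifferentiableOn ℂ F (Metric.ball 0 1) ∧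
    (∃ C : ℝ, ∀ z ∈ Metric.ball (0 : ℂ) 1, ‖F z‖ ≤ C) ∧ IsBoundaryTrace F f

/-- `f` belongs to `H^∞(Λ)`: it is in `H^∞` and its spectrum is contained in `Λ`. -/
def MemHInftySpec (Λ : Set ℕ) (f : Circle → ℂ) : Prop :=
  MemHInfty f ∧ spec f ⊆ ((↑) : ℕ → ℤ) '' Λ

lemma integrable_fourier (f : C(Circle, ℂ)) (k : ℤ) :
    Integrable (fun ζ : Circle => (conj (ζ : ℂ)) ^ k * f ζ) arcLength := by
  have hc : Continuous (fun ζ : Circle => (conj (ζ : ℂ)) ^ k * f ζ) := by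
    refine Continuous.mul (Continuous.zpow₀ (by fun_prop) k fun ζ => Or.inl ?_) (by fun_prop)
    simp
  rw [← integrableOn_univ]
  exact hc.continuousOn.integrableOn_compact isCompact_univ

lemma fourierCoefficient_add (f g : C(Circle, ℂ)) (k : ℤ) :
    fourierCoefficient (f + g : C(Circle, ℂ)) k
      = fourierCoefficient f k + fourierCoefficient g k := by
  simp only [fourierCoefficient, ContinuousMap.add_apply, mul_add]
  rw [integral_add (integrable_fourier f k) (integrable_fourier g k), mul_add]

lemma fourierCoefficient_smul (c : ℂ) (f : C(Circle, ℂ)) (k : ℤ) :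
    fourierCoefficient (c • f : C(Circle, ℂ)) k = c * fourierCoefficient f k := by
  simp only [fourierCoefficient, ContinuousMap.smul_apply, smul_eq_mul, mul_left_comm _ c]
  rw [integral_const_mul, mul_left_comm]

/-- The space `C_A(Λ) = H^∞(Λ) ∩ C(𝕋)`, a linear subspace of `C(𝕋)`; it carries the supremum norm
inherited from `C(𝕋)`. -/
def CA (Λ : Set ℕ) : Submodule ℂ C(Circle, ℂ) where
  carrier := {f | MemHInftySpec Λ f}
  zero_mem' := by
    refine ⟨⟨0, by fun_prop, ⟨0, by simp⟩, ?_⟩, ?_⟩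
    · exact ae_of_all _ fun ζ α _ => tendsto_const_nhds
    · intro k hk
      simp [spec, fourierCoefficient] at hk
  add_mem' := by
    rintro f g ⟨⟨F, hF, ⟨C, hC⟩, hFf⟩, hf⟩ ⟨⟨G, hG, ⟨D, hD⟩, hGg⟩, hg⟩
    refine ⟨⟨F + G, hF.add hG, ⟨C + D, fun z hz => ?_⟩, ?_⟩, ?_⟩
    · exact (norm_add_le _ _).trans (add_le_add (hC z hz) (hD z hz))
    · filter_upwards [hFf, hGg] with ζ h1 h2 α hα
      exact (h1 α hα).add (h2 α hα)
    · intro k hk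
      by_contra hn
      have h1 : fourierCoefficient f k = 0 := by
        by_contra h
        exact hn (hf h)
      have h2 : fourierCoefficient g k = 0 := by
        by_contra h
        exact hn (hg h)
      exact hk (by rw [fourierCoefficient_add, h1, h2, add_zero])
  smul_mem' := by
    rintro c f ⟨⟨F, hF, ⟨C, hC⟩, hFf⟩, hf⟩
    refine ⟨⟨c • F, hF.const_smul c, ⟨‖c‖ * C, fun z hz => ?_⟩, ?_⟩, ?_⟩
    · simpa using mul_le_mul_of_nonneg_left (hC z hz) (norm_nonneg c)
    · filter_upwards [hFf] with ζ h1 α hα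
      exact (h1 α hα).const_smul c
    · intro k hk
      refine hf fun h => hk ?_
      rw [fourierCoefficient_smul, h, mul_zero]

/-- The integral `∫_𝕋 log (1 - |f(ζ)|) |dζ| ∈ [-∞, 0]` of a function with `|f| ≤ 1`, where
`log 0 = -∞`. As the integrand is nonpositive, this is minus the Lebesgue integral of the
`[0, ∞]`-valued function `-log (1 - |f|)`. -/
def logIntegral (f : Circle → ℂ) : EReal :=
  -((∫⁻ ζ : Circle, (-(ENNReal.log (ENNReal.ofReal (1 - ‖f ζ‖)))).toENNReal ∂arcLength : ℝ≥0∞) :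
    EReal)

end DiskAlgebra

end

/-!
Write `φ = 1 - |f|` on the circle; the condition on `f` is that `log φ` is not integrable.

*Non-integrability makes `f` extreme.* If `f = a x + b y` is a proper convex combination of distinct
`x`, `y` in the unit ball, the identity
`|f|² + a b |x - y|² = a |x|² + b |y|² ≤ 1` bounds `φ` below by a multiple of `|x - y|²`
(`lintegral_logMinus_one_sub_norm_ne_top`). But the logarithm of a nonzero `H^∞` function is
integrable on the circle, by Jensen's formula on smaller circles and Fatou's lemma
(`lintegral_logMinus_norm_ne_top`), so `log φ` would be integrable.

*Integrability makes `f` non-extreme.* If `log φ` is integrable, there is a nonzero function `g` of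
the disk algebra with `|g| ≤ C φ` on the circle (`exists_diskAlgebra_norm_le`). As `ℤ₊ \ Λ` is
finite, `h = c z ^ N g` lies in `C_A(Λ)` for large `N`, and `f ± h` lie in the unit ball for small
`c > 0` (`exists_ne_zero_norm_add_norm_le_one`). If `‖f‖ < 1` then `log φ` is bounded, so this
also forces extreme points to have norm one.

The function `g` is an outer function. Its boundary continuity is obtained without smoothness
theory for conjugate functions: `-log φ = ∑ wₙ`, where the layer `wₙ = min (max (-log φ - n) 0) 1`
is continuous and supported in `{φ ≤ exp (-n)}`, and `g = exp (-∑ Hₙ)`, where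
`Hₙ (z) = H[wₙ] (rₙ z)` is a dilated Herglotz transform, with `rₙ < 1` so close to `1` that
`Re Hₙ ≥ wₙ - 2⁻ⁿ` on the circle. The series converges locally uniformly on the closed disk away
from the zeros of `φ`, because there `|Hₙ|` is controlled by `∫ wₙ`, and near the zeros of `φ`
the partial products are small (`exists_tendstoLocallyUniformlyOn_exp_neg_sum`).
-/

namespace DiskAlgebra

/-! ### The Herglotz transform -/

/-- The Herglotz transform of a real function `w` on the unit circle: the analytic function on the
disk whose real part is the Poisson integral of `w`. -/
noncomputable def herglotz (w : ℂ → ℝ) (z : ℂ) : ℂ :=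
  Real.circleAverage (fun ζ => herglotzRieszKernel 0 z ζ • (w ζ : ℂ)) 0 1

lemma analyticOnNhd_herglotz {w : ℂ → ℝ} (hw : Continuous w) :
    AnalyticOnNhd ℂ (herglotz w) (Metric.ball 0 1) :=
  analyticOnNhd_circleAverage_herglotzRieszKernel_smul
    (ContinuousOn.circleIntegrable zero_le_one (by fun_prop))

lemma continuousOn_poissonKernel {z : ℂ} (hz : z ∈ Metric.ball (0 : ℂ) 1) :
    ContinuousOn (poissonKernel 0 z) (Metric.sphere 0 1) := by
  rw [poissonKernel_eq_re_herglotzRieszKernel]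
  have := continuousOn_herglotzRieszKernel_sphere hz
  rw [abs_one] at this
  exact Complex.continuous_re.comp_continuousOn this

lemma re_herglotz {w : ℂ → ℝ} (hw : Continuous w) {z : ℂ} (hz : z ∈ Metric.ball (0 : ℂ) 1) :
    (herglotz w z).re = Real.circleAverage (fun ζ => poissonKernel 0 z ζ * w ζ) 0 1 := by
  rw [herglotz, re_circleAverage_herglotzRieszKernel_smul
    (ContinuousOn.circleIntegrable zero_le_one (by fun_prop)) hz,
    ← poissonKernel_eq_re_herglotzRieszKernel]
  rfl

lemma circleAverage_poissonKernel {z : ℂ} (hz : z ∈ Metric.ball (0 : ℂ) 1) :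
    Real.circleAverage (poissonKernel 0 z) 0 1 = 1 := by
  have h : DiffContOnCl ℂ (fun _ : ℂ => (1 : ℂ)) (Metric.ball 0 1) := diffContOnCl_const
  have h1 := congrArg Complex.re (h.circleAverage_poissonKernel_smul hz)
  have h2 := Complex.reCLM.circleAverage_comp_comm
    (f := poissonKernel 0 z • fun _ : ℂ => (1 : ℂ)) (c := 0) (R := 1)
    (ContinuousOn.circleIntegrable zero_le_one
      ((continuousOn_poissonKernel hz).smul continuousOn_const))
  rw [Complex.reCLM_apply, h1] at h2
  simpa [Function.comp_def] using h2

lemma poissonKernel_nonneg {z ζ : ℂ} (hz : z ∈ Metric.ball (0 : ℂ) 1)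
    (hζ : ζ ∈ Metric.sphere (0 : ℂ) 1) : 0 ≤ poissonKernel 0 z ζ := by
  rw [mem_ball_zero_iff] at hz
  rw [mem_sphere_zero_iff_norm] at hζ
  rw [poissonKernel_def, sub_zero, sub_zero, hζ]
  have : ‖z‖ ^ 2 ≤ 1 := by nlinarith [norm_nonneg z]
  exact div_nonneg (by linarith) (by positivity)

lemma circleIntegrable_poissonKernel_mul {w : ℂ → ℝ} (hw : Continuous w) {z : ℂ}
    (hz : z ∈ Metric.ball (0 : ℂ) 1) :
    CircleIntegrable (fun ζ => poissonKernel 0 z ζ * w ζ) 0 1 :=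
  ContinuousOn.circleIntegrable zero_le_one
    ((continuousOn_poissonKernel hz).mul hw.continuousOn)

lemma re_herglotz_nonneg {w : ℂ → ℝ} (hw : Continuous w) (h0 : ∀ ζ, 0 ≤ w ζ) {z : ℂ}
    (hz : z ∈ Metric.ball (0 : ℂ) 1) : 0 ≤ (herglotz w z).re := by
  rw [re_herglotz hw hz]
  refine Real.circleAverage_nonneg_of_nonneg fun ζ hζ => ?_
  rw [abs_one] at hζ
  exact mul_nonneg (poissonKernel_nonneg hz hζ) (h0 ζ)

/-- Away from the support of `w`, the Herglotz transform is controlled by the mean of `w`. -/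
lemma norm_herglotz_le {w : ℂ → ℝ} (hw : Continuous w) (h0 : ∀ ζ, 0 ≤ w ζ) {z : ℂ}
    (hz : z ∈ Metric.ball (0 : ℂ) 1) {d : ℝ} (hd : 0 < d)
    (hsupp : ∀ ζ ∈ Metric.sphere (0 : ℂ) 1, w ζ ≠ 0 → d ≤ ‖ζ - z‖) :
    ‖herglotz w z‖ ≤ 2 / d * Real.circleAverage w 0 1 := by
  have key : ∀ ζ ∈ Metric.sphere (0 : ℂ) 1,
      ‖herglotzRieszKernel 0 z ζ • (w ζ : ℂ)‖ ≤ 2 / d * w ζ := by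
    intro ζ hζ
    rcases eq_or_ne (w ζ) 0 with h | h
    · simp [h]
    · rw [norm_smul, Complex.norm_real, Real.norm_of_nonneg (h0 ζ)]
      refine mul_le_mul_of_nonneg_right ?_ (h0 ζ)
      rw [herglotzRieszKernel_def, sub_zero, sub_zero, norm_div]
      rw [mem_ball_zero_iff] at hz
      rw [mem_sphere_zero_iff_norm] at hζ
      have h2 : ‖ζ + z‖ ≤ 2 := (norm_add_le _ _).trans (by linarith)
      exact div_le_div₀ zero_le_two h2 hd (hsupp ζ (by simpa using hζ) h)
  have hpi : (0 : ℝ) ≤ (2 * Real.pi)⁻¹ := by positivity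
  rw [herglotz, Real.circleAverage_def, Real.circleAverage_def, norm_smul,
    Real.norm_of_nonneg hpi, smul_eq_mul, mul_left_comm]
  refine mul_le_mul_of_nonneg_left ?_ hpi
  rw [← intervalIntegral.integral_const_mul]
  refine intervalIntegral.norm_integral_le_of_norm_le (by positivity)
    (ae_of_all _ fun t _ => key _ (circleMap_mem_sphere 0 zero_le_one t)) ?_
  exact (by fun_prop : Continuous fun t => 2 / d * w (circleMap 0 1 t)).intervalIntegrable _ _

/-- The Poisson kernel is an approximate identity: on circles close to the unit circle, the Poisson
integral of a nonnegative continuous function is, up to a given error, at least that function. -/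
lemma exists_radius_le_re_herglotz {w : ℂ → ℝ} (hw : Continuous w) (h0 : ∀ ζ, 0 ≤ w ζ) {ε : ℝ}
    (hε : 0 < ε) :
    ∃ r₀ < (1 : ℝ), ∀ r, r₀ ≤ r → 0 ≤ r → r < 1 → ∀ η ∈ Metric.sphere (0 : ℂ) 1,
      w η - ε ≤ (herglotz w (r * η)).re := by
  have hK : IsCompact (Metric.sphere (0 : ℂ) 1) := isCompact_sphere 0 1
  obtain ⟨M, hM⟩ := hK.exists_bound_of_continuousOn hw.continuousOn
  have hM0 : 0 ≤ M := (norm_nonneg _).trans (hM 1 (by simp))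
  obtain ⟨δ, hδ, hδw⟩ := Metric.uniformContinuousOn_iff.1
    (hK.uniformContinuousOn_of_continuous hw.continuousOn) (ε / 2) (by positivity)
  -- The radii for which the kernel, at distance at least `δ` from its pole, costs at most `ε / 2`.
  obtain ⟨s, hs0, hsδ, hsM⟩ : ∃ s > 0, s ≤ δ / 2 ∧ M * (2 * s * (4 / δ ^ 2)) ≤ ε / 2 := by
    refine ⟨min (δ / 2) (ε * δ ^ 2 / (16 * (M + 1))), by positivity, min_le_left _ _, ?_⟩
    have h1 : min (δ / 2) (ε * δ ^ 2 / (16 * (M + 1))) ≤ ε * δ ^ 2 / (16 * (M + 1)) :=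
      min_le_right _ _
    calc M * (2 * min (δ / 2) (ε * δ ^ 2 / (16 * (M + 1))) * (4 / δ ^ 2))
        ≤ M * (2 * (ε * δ ^ 2 / (16 * (M + 1))) * (4 / δ ^ 2)) := by gcongr
      _ = ε / 2 * (M / (M + 1)) := by field_simp; ring
      _ ≤ ε / 2 * 1 := by
          gcongr
          rw [div_le_one (by positivity)]
          linarith
      _ = ε / 2 := mul_one _
  refine ⟨1 - s, by linarith, fun r hr hr0 hr1 η hη => ?_⟩
  have hη1 : ‖η‖ = 1 := by simpa using hη
  have hrη : ‖(r : ℂ) * η‖ = r := by simp [hη1, abs_of_nonneg hr0]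
  have hz : (r : ℂ) * η ∈ Metric.ball (0 : ℂ) 1 := by simpa [hη1, abs_of_nonneg hr0] using hr1
  rw [re_herglotz hw hz]
  set P := poissonKernel 0 ((r : ℂ) * η) with hP
  have hwη : w η ≤ M := (le_abs_self _).trans (hM η hη)
  set B := M * (2 * s * (4 / δ ^ 2)) with hB
  have hPint : CircleIntegrable P 0 1 :=
    ContinuousOn.circleIntegrable zero_le_one (continuousOn_poissonKernel hz)
  have hint : CircleIntegrable (fun ζ => (w η - ε / 2) * P ζ - B) 0 1 :=
    ContinuousOn.circleIntegrable zero_le_one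
      ((continuousOn_const.mul (continuousOn_poissonKernel hz)).sub continuousOn_const)
  have hlow : ∀ ζ ∈ Metric.sphere (0 : ℂ) |1|, (w η - ε / 2) * P ζ - B ≤ P ζ * w ζ := by
    intro ζ hζ
    rw [abs_one] at hζ
    have hP0 : 0 ≤ P ζ := poissonKernel_nonneg hz hζ
    have hB0 : 0 ≤ B := by positivity
    rcases lt_or_ge (dist ζ η) δ with h | h
    · have h1 := hδw ζ hζ η hη h
      rw [Real.dist_eq, abs_lt] at h1
      nlinarith
    · have h2 : δ / 2 ≤ ‖ζ - r * η‖ := by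
        have h3 : ‖(r : ℂ) * η - η‖ = 1 - r := by
          rw [show (r : ℂ) * η - η = ((r - 1 : ℝ) : ℂ) * η by push_cast; ring, norm_mul, hη1,
            Complex.norm_real, mul_one, Real.norm_eq_abs, abs_sub_comm,
            abs_of_nonneg (by linarith)]
        have h4 : ‖ζ - η‖ ≤ ‖ζ - r * η‖ + ‖(r : ℂ) * η - η‖ := by
          simpa using norm_add_le (ζ - r * η) ((r : ℂ) * η - η)
        rw [dist_eq_norm] at h
        linarith
      have hPle : P ζ ≤ 2 * s * (4 / δ ^ 2) := by
        have hζ1 : ‖ζ‖ = 1 := by simpa using hζ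
        rw [hP, poissonKernel_def, sub_zero, sub_zero, hζ1, hrη]
        calc (1 ^ 2 - r ^ 2) / ‖ζ - r * η‖ ^ 2 ≤ (2 * s) / (δ / 2) ^ 2 := by
              gcongr
              nlinarith
          _ = 2 * s * (4 / δ ^ 2) := by field_simp; ring
      have h5 : (w η - ε / 2) * P ζ ≤ M * (2 * s * (4 / δ ^ 2)) :=
        (mul_le_mul_of_nonneg_right (by linarith) hP0).trans
          (mul_le_mul_of_nonneg_left hPle hM0)
      have h6 : 0 ≤ P ζ * w ζ := mul_nonneg hP0 (h0 ζ)
      linarith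
  have hmono := Real.circleAverage_mono hint (circleIntegrable_poissonKernel_mul hw hz) hlow
  have hcalc : Real.circleAverage (fun ζ => (w η - ε / 2) * P ζ - B) 0 1 = w η - ε / 2 - B := by
    have h1 : CircleIntegrable (fun ζ => (w η - ε / 2) * P ζ) 0 1 := hPint.const_mul _
    rw [Real.circleAverage_fun_sub h1 (circleIntegrable_const _ _ _), Real.circleAverage_const]
    have h2 := Real.circleAverage_fun_smul (a := w η - ε / 2) (f := P) (c := 0) (R := 1)
    simp only [smul_eq_mul] at h2
    rw [h2, circleAverage_poissonKernel hz, mul_one]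
  rw [hcalc] at hmono
  linarith

/-! ### An infinite product converging up to the circle -/

/-- Convergence of the infinite product `∏ exp (-Hₙ)`, for functions with nonnegative real parts:
off an exceptional set `E` the series `∑ Hₙ` converges locally uniformly, whereas on `E` its real
part diverges to `∞`. As the moduli of the partial products decrease, the divergence makes
them locally uniformly small near `E`. -/
lemma exists_tendstoLocallyUniformlyOn_exp_neg_sum {H : ℕ → ℂ → ℂ} {K E : Set ℂ}
    (hc : ∀ n, ContinuousOn (H n) K) (hre : ∀ n, ∀ z ∈ K, 0 ≤ (H n z).re)
    (hloc : ∀ z₀ ∈ K \ E, ∃ u : ℕ → ℝ, Summable u ∧ ∃ t ∈ 𝓝[K] z₀,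
      ∀ᶠ n in atTop, ∀ z ∈ t, ‖H n z‖ ≤ u n)
    (hE : ∀ z₀ ∈ K ∩ E, Tendsto (fun N => ∑ n ∈ Finset.range N, (H n z₀).re) atTop atTop) :
    ∃ g : ℂ → ℂ, TendstoLocallyUniformlyOn
      (fun N z => Complex.exp (-∑ n ∈ Finset.range N, H n z)) g atTop K ∧
      ∀ z ∈ K \ E, g z ≠ 0 := by
  classical
  set G : ℕ → ℂ → ℂ := fun N z => Complex.exp (-∑ n ∈ Finset.range N, H n z) with hG
  have hGnorm : ∀ N z, ‖G N z‖ = Real.exp (-∑ n ∈ Finset.range N, (H n z).re) := fun N z => by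
    rw [hG, Complex.norm_exp, Complex.neg_re, Complex.re_sum]
  have hanti : ∀ z ∈ K, Antitone fun N => ‖G N z‖ := fun z hz =>
    antitone_nat_of_succ_le fun N => by
      rw [hGnorm, hGnorm, Real.exp_le_exp, Finset.sum_range_succ]
      linarith [hre N z hz]
  set g : ℂ → ℂ := fun z => if z ∈ E then 0 else Complex.exp (-∑' n, H n z) with hg
  have hunif : ∀ z₀ ∈ K \ E, ∃ t ∈ 𝓝[K] z₀,
      TendstoUniformlyOn G (fun z => Complex.exp (-∑' n, H n z)) atTop (t ∩ K) := by
    intro z₀ hz₀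
    obtain ⟨u, hu, t, ht, hle⟩ := hloc z₀ hz₀
    refine ⟨t, ht, ?_⟩
    have h1 := (tendstoUniformlyOn_tsum_nat_eventually hu hle).mono (inter_subset_left (t := K))
    refine h1.neg.comp_cexp ⟨0, ?_⟩
    rintro _ ⟨z, hz, rfl⟩
    have h2 := h1.tendsto_at hz
    have h3 := (Complex.continuous_re.tendsto _).comp h2
    have h4 : 0 ≤ (∑' n, H n z).re := ge_of_tendsto' h3 fun N => by
      rw [Function.comp_apply, Complex.re_sum]
      exact Finset.sum_nonneg fun n _ => hre n z hz.2
    simpa using h4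
  have hptE : ∀ z ∈ K ∩ E, Tendsto (fun N => G N z) atTop (𝓝 0) := by
    intro z hz
    rw [tendsto_zero_iff_norm_tendsto_zero]
    simp only [hGnorm]
    exact Real.tendsto_exp_neg_atTop_nhds_zero.comp (hE z hz)
  have hpt : ∀ z ∈ K, Tendsto (fun N => G N z) atTop (𝓝 (g z)) := by
    intro z hz
    by_cases hzE : z ∈ E
    · simpa [hg, hzE] using hptE z ⟨hz, hzE⟩
    · obtain ⟨t, ht, hlim⟩ := hunif z ⟨hz, hzE⟩
      simpa [hg, hzE] using hlim.tendsto_at ⟨mem_of_mem_nhdsWithin hz ht, hz⟩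
  have hGc : ∀ N, ContinuousOn (G N) K := fun N =>
    Complex.continuous_exp.comp_continuousOn
      (continuousOn_finsetSum _ fun n _ => hc n).neg
  refine ⟨g, ?_, fun z hz => by simp [hg, hz.2]⟩
  rw [Metric.tendstoLocallyUniformlyOn_iff]
  intro ε hε z₀ hz₀
  by_cases hzE : z₀ ∈ E
  · -- Near `E`, one small partial product bounds all later ones, and hence the limit.
    obtain ⟨N₀, hN₀⟩ : ∃ N, ‖G N z₀‖ < ε / 2 :=
      ((hptE z₀ ⟨hz₀, hzE⟩).norm.eventually_lt_const (by simpa using half_pos hε)).exists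
    refine ⟨{z | ‖G N₀ z‖ < ε / 2} ∩ K, inter_mem
      ((hGc N₀ z₀ hz₀).norm.eventually_lt_const hN₀) self_mem_nhdsWithin, ?_⟩
    filter_upwards [eventually_ge_atTop N₀] with N hN z hz
    have h1 : ‖G N z‖ ≤ ‖G N₀ z‖ := hanti z hz.2 hN
    have h2 : ‖g z‖ ≤ ‖G N₀ z‖ := le_of_tendsto (hpt z hz.2).norm <| by
      filter_upwards [eventually_ge_atTop N₀] with n hn using hanti z hz.2 hn
    rw [dist_eq_norm]
    have h3 : ‖G N₀ z‖ < ε / 2 := hz.1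
    linarith [norm_sub_le (g z) (G N z)]
  · obtain ⟨t, ht, hlim⟩ := hunif z₀ ⟨hz₀, hzE⟩
    refine ⟨t ∩ K, inter_mem ht self_mem_nhdsWithin, ?_⟩
    filter_upwards [Metric.tendstoUniformlyOn_iff.1 hlim ε hε] with N hN z hz
    have h1 : g z = Complex.exp (-∑' n, H n z) :=
      tendsto_nhds_unique (hpt z hz.2) (hlim.tendsto_at hz)
    rw [h1]
    exact hN z hz

/-! ### Outer functions in the disk algebra -/

/-- The function `-log φ`, truncated at height `N`. -/
noncomputable def negLogTrunc (φ : ℂ → ℝ) (N : ℕ) (z : ℂ) : ℝ :=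
  -Real.log (max (φ z) (Real.exp (-N)))

section negLogTrunc

variable {φ : ℂ → ℝ}

lemma continuous_negLogTrunc (hφ : Continuous φ) (N : ℕ) : Continuous (negLogTrunc φ N) :=
  ((hφ.max continuous_const).log fun _ => (lt_max_of_lt_right (Real.exp_pos _)).ne').neg

lemma negLogTrunc_zero (h1 : ∀ z, φ z ≤ 1) (z : ℂ) : negLogTrunc φ 0 z = 0 := by
  simp [negLogTrunc, h1 z]

lemma negLogTrunc_le_succ (N : ℕ) (z : ℂ) : negLogTrunc φ N z ≤ negLogTrunc φ (N + 1) z := by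
  refine neg_le_neg (Real.log_le_log (lt_max_of_lt_right (Real.exp_pos _)) ?_)
  refine max_le_max le_rfl (Real.exp_le_exp.2 ?_)
  push_cast
  linarith

lemma negLogTrunc_succ_eq {N : ℕ} {z : ℂ} (h : Real.exp (-N) ≤ φ z) :
    negLogTrunc φ (N + 1) z = negLogTrunc φ N z := by
  have h' : Real.exp (-((N + 1 : ℕ) : ℝ)) ≤ φ z := le_trans (Real.exp_le_exp.2 (by simp)) h
  rw [negLogTrunc, negLogTrunc, max_eq_left h, max_eq_left h']

lemma exp_neg_negLogTrunc (N : ℕ) (z : ℂ) :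
    Real.exp (-negLogTrunc φ N z) = max (φ z) (Real.exp (-N)) := by
  rw [negLogTrunc, neg_neg, Real.exp_log (lt_max_of_lt_right (Real.exp_pos _))]

end negLogTrunc

/-- A continuous function `0 ≤ φ ≤ 1` on the circle with `∫ log φ > -∞` dominates, up to a constant
factor, the modulus of a nonzero function of the disk algebra. That function is
`exp (-∑ Hₙ)`, where `-log φ` is cut into the layers `wₙ`, and `Hₙ` is the Herglotz transform of
`wₙ`, dilated to be continuous up to the circle. As `wₙ` lives where `φ < exp (-n)`, the series
converges locally uniformly off the zeros of `φ`. -/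
theorem exists_diskAlgebra_norm_le {φ : ℂ → ℝ} (hφ : Continuous φ) (h0 : ∀ z, 0 ≤ φ z)
    (h1 : ∀ z, φ z ≤ 1) {I : ℝ} (hI : ∀ N, Real.circleAverage (negLogTrunc φ N) 0 1 ≤ I) :
    ∃ g : ℂ → ℂ, ContinuousOn g (Metric.closedBall 0 1) ∧
      DifferentiableOn ℂ g (Metric.ball 0 1) ∧ g 0 ≠ 0 ∧
      ∀ z ∈ Metric.sphere (0 : ℂ) 1, ‖g z‖ ≤ Real.exp 2 * φ z := by
  set w : ℕ → ℂ → ℝ := fun n z => negLogTrunc φ (n + 1) z - negLogTrunc φ n z with hw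
  have hwc : ∀ n, Continuous (w n) := fun n =>
    (continuous_negLogTrunc hφ _).sub (continuous_negLogTrunc hφ _)
  have hw0 : ∀ n z, 0 ≤ w n z := fun n z => sub_nonneg.2 (negLogTrunc_le_succ n z)
  have hwsum : ∀ N z, ∑ n ∈ Finset.range N, w n z = negLogTrunc φ N z := fun N z => by
    rw [hw, Finset.sum_range_sub (fun n => negLogTrunc φ n z), negLogTrunc_zero h1, sub_zero]
  have hwsupp : ∀ n z, w n z ≠ 0 → φ z < Real.exp (-n) := fun n z h => by
    by_contra! h'
    exact h (sub_eq_zero.2 (negLogTrunc_succ_eq h'))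
  have hwsummable : Summable fun n => Real.circleAverage (w n) 0 1 := by
    refine summable_of_sum_range_le (c := I)
      (fun n => Real.circleAverage_nonneg_of_nonneg fun z _ => hw0 n z) fun N => ?_
    rw [← Real.circleAverage_fun_sum
      fun n _ => ContinuousOn.circleIntegrable zero_le_one (hwc n).continuousOn]
    simpa only [hwsum] using hI N
  have hr : ∀ n : ℕ, ∃ r : ℝ, 0 ≤ r ∧ r < 1 ∧ 1 - r ≤ 1 / ((n : ℝ) + 1) ∧
      ∀ η ∈ Metric.sphere (0 : ℂ) 1, w n η - (1 / 2) ^ n ≤ (herglotz (w n) (r * η)).re := by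
    intro n
    obtain ⟨r₀, hr₀, h⟩ :=
      exists_radius_le_re_herglotz (hwc n) (hw0 n) (ε := (1 / 2) ^ n) (by positivity)
    have hn : (0 : ℝ) < 1 / ((n : ℝ) + 1) := by positivity
    have hn1 : 1 / ((n : ℝ) + 1) ≤ 1 := by
      rw [div_le_one (by positivity)]
      linarith [n.cast_nonneg (α := ℝ)]
    have hlt : max r₀ (1 - 1 / ((n : ℝ) + 1)) < 1 := max_lt hr₀ (by linarith)
    have hle : 1 - 1 / ((n : ℝ) + 1) ≤ max r₀ (1 - 1 / ((n : ℝ) + 1)) := le_max_right _ _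
    exact ⟨_, by linarith, hlt, by linarith, h _ (le_max_left _ _) (by linarith) hlt⟩
  choose r hr0 hr1 hrn hrw using hr
  set H : ℕ → ℂ → ℂ := fun n z => herglotz (w n) (r n * z) with hH
  have hmaps : ∀ n, MapsTo (fun z : ℂ => (r n : ℂ) * z) (Metric.closedBall 0 1)
      (Metric.ball 0 1) := by
    intro n z hz
    rw [mem_closedBall_zero_iff] at hz
    rw [mem_ball_zero_iff, norm_mul, Complex.norm_real, Real.norm_of_nonneg (hr0 n)]
    nlinarith [hr0 n, hr1 n]
  have hHc : ∀ n, ContinuousOn (H n) (Metric.closedBall 0 1) := fun n =>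
    (analyticOnNhd_herglotz (hwc n)).continuousOn.comp (by fun_prop) (hmaps n)
  have hHd : ∀ n, DifferentiableOn ℂ (H n) (Metric.ball 0 1) := fun n =>
    (analyticOnNhd_herglotz (hwc n)).differentiableOn.comp (by fun_prop)
      ((hmaps n).mono_left Metric.ball_subset_closedBall)
  have hHre : ∀ n, ∀ z ∈ Metric.closedBall (0 : ℂ) 1, 0 ≤ (H n z).re := fun n z hz =>
    re_herglotz_nonneg (hwc n) (hw0 n) (hmaps n hz)
  have hHsum : ∀ N, ∀ η ∈ Metric.sphere (0 : ℂ) 1,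
      negLogTrunc φ N η - 2 ≤ ∑ n ∈ Finset.range N, (H n η).re := by
    intro N η hη
    have h2 : ∑ n ∈ Finset.range N, (w n η - (1 / 2 : ℝ) ^ n) ≤
        ∑ n ∈ Finset.range N, (H n η).re := Finset.sum_le_sum fun n _ => hrw n η hη
    rw [Finset.sum_sub_distrib, hwsum] at h2
    have h3 : ∑ n ∈ Finset.range N, (1 / 2 : ℝ) ^ n ≤ 2 := by
      exact (summable_geometric_two.sum_le_tsum _ fun _ _ => by positivity).trans_eq
        tsum_geometric_two
    linarith
  set E : Set ℂ := {z | ‖z‖ = 1 ∧ φ z = 0} with hE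
  have hloc : ∀ z₀ ∈ Metric.closedBall (0 : ℂ) 1 \ E, ∃ u : ℕ → ℝ, Summable u ∧
      ∃ t ∈ 𝓝[Metric.closedBall 0 1] z₀, ∀ᶠ n in atTop, ∀ z ∈ t, ‖H n z‖ ≤ u n := by
    intro z₀ hz₀
    obtain ⟨hz₀K, hz₀E⟩ := hz₀
    have hz₀1 : ‖z₀‖ ≤ 1 := by simpa using hz₀K
    obtain ⟨d, hd, c, hc, hdc⟩ : ∃ d > 0, ∃ c > 0, ∀ ζ ∈ Metric.sphere (0 : ℂ) 1,
        φ ζ < c → 3 * d ≤ ‖ζ - z₀‖ := by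
      rcases hz₀1.lt_or_eq with hlt | heq
      · refine ⟨(1 - ‖z₀‖) / 3, by linarith, 1, one_pos, fun ζ hζ _ => ?_⟩
        have hζ1 : ‖ζ‖ = 1 := by simpa using hζ
        linarith [norm_sub_norm_le ζ z₀]
      · have hpos : 0 < φ z₀ := (h0 z₀).lt_of_ne fun h => hz₀E ⟨heq, h.symm⟩
        obtain ⟨δ, hδ, hball⟩ := Metric.eventually_nhds_iff.1
          (hφ.continuousAt.eventually_const_lt (half_lt_self hpos))
        refine ⟨δ / 3, by positivity, φ z₀ / 2, by positivity, fun ζ _ hlt => ?_⟩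
        by_contra! h
        exact (hball (by rw [dist_eq_norm]; linarith)).not_gt hlt
    refine ⟨fun n => 2 / d * Real.circleAverage (w n) 0 1, hwsummable.mul_left _,
      Metric.ball z₀ d ∩ Metric.closedBall 0 1,
      inter_mem (mem_nhdsWithin_of_mem_nhds (Metric.ball_mem_nhds _ hd)) self_mem_nhdsWithin, ?_⟩
    have hexp : ∀ᶠ n : ℕ in atTop, Real.exp (-n) < c :=
      (Real.tendsto_exp_neg_atTop_nhds_zero.comp
        tendsto_natCast_atTop_atTop).eventually_lt_const hc
    have hrad : ∀ᶠ n : ℕ in atTop, 1 / ((n : ℝ) + 1) < d :=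
      tendsto_one_div_add_atTop_nhds_zero_nat.eventually_lt_const hd
    filter_upwards [hexp, hrad] with n hn1 hn2 z hz
    refine norm_herglotz_le (hwc n) (hw0 n) (hmaps n hz.2) hd fun ζ hζ hζw => ?_
    have h2 := hdc ζ hζ ((hwsupp n ζ hζw).trans hn1)
    have h3 : ‖z - z₀‖ < d := by simpa [dist_eq_norm] using hz.1
    have h4 : ‖(r n : ℂ) * z - z‖ ≤ d := by
      have hz1 : ‖z‖ ≤ 1 := by simpa using hz.2
      rw [show (r n : ℂ) * z - z = ((r n - 1 : ℝ) : ℂ) * z by push_cast; ring, norm_mul,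
        Complex.norm_real, Real.norm_eq_abs, abs_sub_comm, abs_of_nonneg (by linarith [hr1 n])]
      have := hrn n
      nlinarith [norm_nonneg z, hr1 n]
    have h5 : ‖ζ - z₀‖ ≤ ‖ζ - r n * z‖ + ‖(r n : ℂ) * z - z‖ + ‖z - z₀‖ := by
      refine le_trans (le_of_eq ?_) (norm_add₃_le (a := ζ - r n * z))
      congr 1
      ring
    linarith
  have hdiv : ∀ z₀ ∈ Metric.closedBall (0 : ℂ) 1 ∩ E,
      Tendsto (fun N => ∑ n ∈ Finset.range N, (H n z₀).re) atTop atTop := by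
    intro z₀ hz₀
    have hη : z₀ ∈ Metric.sphere (0 : ℂ) 1 := by simpa using hz₀.2.1
    refine tendsto_atTop_mono (fun N => hHsum N z₀ hη) ?_
    have h2 : ∀ N : ℕ, negLogTrunc φ N z₀ - 2 = (N : ℝ) + -2 := fun N => by
      rw [negLogTrunc, hz₀.2.2, max_eq_right (Real.exp_pos _).le, Real.log_exp, neg_neg,
        sub_eq_add_neg]
    simp only [h2]
    exact tendsto_atTop_add_const_right _ _ tendsto_natCast_atTop_atTop
  obtain ⟨g, hg, hgne⟩ := exists_tendstoLocallyUniformlyOn_exp_neg_sum hHc hHre hloc hdiv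
  refine ⟨g, hg.continuousOn (Frequently.of_forall fun N => ?_),
    (hg.mono Metric.ball_subset_closedBall).differentiableOn (.of_forall fun N => ?_)
      Metric.isOpen_ball, hgne 0 (by simp [hE]), fun z hz => ?_⟩
  · exact Complex.continuous_exp.comp_continuousOn
      (continuousOn_finsetSum _ fun n _ => hHc n).neg
  · exact (DifferentiableOn.fun_sum fun n _ => hHd n).neg.cexp
  · have hlim : Tendsto (fun N : ℕ => Real.exp 2 * max (φ z) (Real.exp (-N))) atTop
        (𝓝 (Real.exp 2 * max (φ z) 0)) :=
      (tendsto_const_nhds.max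
        (Real.tendsto_exp_neg_atTop_nhds_zero.comp tendsto_natCast_atTop_atTop)).const_mul _
    rw [max_eq_left (h0 z)] at hlim
    refine le_of_tendsto_of_tendsto'
      (hg.tendsto_at (Metric.sphere_subset_closedBall hz)).norm hlim fun N => ?_
    rw [Complex.norm_exp, Complex.neg_re, Complex.re_sum, ← exp_neg_negLogTrunc, ← Real.exp_add,
      Real.exp_le_exp]
    linarith [hHsum N z hz]

/-! ### Arc length and circle averages -/

lemma measurable_circleExp : Measurable Circle.exp := Circle.exp.continuous.measurable

lemma circleMap_zero_one_eq (θ : ℝ) : circleMap 0 1 θ = (Circle.exp θ : ℂ) := by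
  simp [circleMap]

lemma circleAverage_eq_integral_arcLength {E : Type*} [NormedAddCommGroup E] [NormedSpace ℝ E]
    {F : ℂ → E} (hF : AEStronglyMeasurable (fun ζ : Circle => F ζ) arcLength) :
    Real.circleAverage F 0 1 = (2 * Real.pi)⁻¹ • ∫ ζ : Circle, F ζ ∂arcLength := by
  rw [Real.circleAverage_eq_integral_add (-Real.pi),
    intervalIntegral.integral_comp_add_right (fun θ => F (circleMap 0 1 θ)), arcLength,
    integral_map measurable_circleExp.aemeasurable hF,
    intervalIntegral.integral_of_le (by linarith [Real.pi_pos])]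
  simp only [circleMap_zero_one_eq, zero_add]
  ring_nf

lemma integrable_arcLength {E : Type*} [NormedAddCommGroup E] {F : ℂ → E}
    (hF : AEStronglyMeasurable (fun ζ : Circle => F ζ) arcLength) (hi : CircleIntegrable F 0 1) :
    Integrable (fun ζ : Circle => F ζ) arcLength := by
  rw [arcLength, integrable_map_measure hF measurable_circleExp.aemeasurable]
  have hper : Function.Periodic (fun θ => F (circleMap 0 1 θ)) (2 * Real.pi) := fun θ => by
    simp only [periodic_circleMap 0 1 θ]
  have h1 := hper.intervalIntegrable (t := 0) (by positivity)
    (by simpa [CircleIntegrable] using hi) (-Real.pi) Real.pi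
  rw [intervalIntegrable_iff_integrableOn_Ioc_of_le (by linarith [Real.pi_pos])] at h1
  simpa only [circleMap_zero_one_eq, IntegrableOn, Function.comp_def] using h1

lemma eq_zero_of_ae_eq_zero {h : C(Circle, ℂ)} (hh : ∀ᵐ ζ ∂arcLength, h ζ = 0) : h = 0 := by
  have h1 := ae_of_ae_map measurable_circleExp.aemeasurable hh
  have h2 : EqOn (fun θ => h (Circle.exp θ)) 0 (Ioc (-Real.pi) Real.pi) :=
    Measure.eqOn_Ioc_of_ae_eq volume h1 (by fun_prop) (by fun_prop)
  ext ζ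
  have := h2 (Complex.arg_mem_Ioc (ζ : ℂ))
  simpa [Circle.exp_arg] using this

/-! ### The negative part of the logarithm -/

/-- The function `log⁻ t = max (-log t) 0` with values in `[0, ∞]`, where `log⁻ 0 = ∞`. -/
noncomputable def logMinus (t : ℝ) : ℝ≥0∞ := (-ENNReal.log (ENNReal.ofReal t)).toENNReal

lemma continuous_logMinus : Continuous logMinus :=
  EReal.continuous_toENNReal.comp <| continuous_neg.comp <|
    ENNReal.continuous_log.comp ENNReal.continuous_ofReal

lemma antitone_logMinus : Antitone logMinus := fun _ _ h =>
  EReal.toENNReal_le_toENNReal <| EReal.neg_le_neg_iff.2 <|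
    ENNReal.log_le_log (ENNReal.ofReal_le_ofReal h)

lemma logMinus_of_pos {t : ℝ} (ht : 0 < t) : logMinus t = ENNReal.ofReal (-Real.log t) := by
  rw [logMinus, ENNReal.log_ofReal_of_pos ht, ← EReal.coe_neg, EReal.toENNReal_of_ne_top (by simp),
    EReal.toReal_coe]

lemma logMinus_of_nonpos {t : ℝ} (ht : t ≤ 0) : logMinus t = ⊤ := by
  rw [logMinus, ENNReal.ofReal_of_nonpos ht, ENNReal.log_zero, EReal.neg_bot, EReal.toENNReal_top]

lemma logMinus_mul_le {s t : ℝ} (hs : 0 < s) : logMinus (s * t) ≤ logMinus s + logMinus t := by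
  rcases le_or_gt t 0 with ht | ht
  · rw [logMinus_of_nonpos ht, add_top]
    exact le_top
  · rw [logMinus_of_pos hs, logMinus_of_pos ht, logMinus_of_pos (mul_pos hs ht),
      Real.log_mul hs.ne' ht.ne', neg_add]
    exact ENNReal.ofReal_add_le

lemma logIntegral_eq_bot_iff {f : Circle → ℂ} :
    logIntegral f = ⊥ ↔ ∫⁻ ζ, logMinus (1 - ‖f ζ‖) ∂arcLength = ⊤ := by
  rw [logIntegral, EReal.neg_eq_bot_iff, EReal.coe_ennreal_eq_top_iff]
  rfl

/-! ### Logarithmic integrability of bounded holomorphic functions -/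

lemma ofReal_mul_mem_ball {r : ℝ} (h0 : 0 ≤ r) (h1 : r < 1) (ζ : Circle) :
    (r : ℂ) * ζ ∈ Metric.ball (0 : ℂ) 1 := by
  simpa [abs_of_nonneg h0, Circle.norm_coe] using h1

lemma continuous_dilation {F : ℂ → ℂ} (hF : DifferentiableOn ℂ F (Metric.ball 0 1)) {r : ℝ}
    (h0 : 0 ≤ r) (h1 : r < 1) : Continuous fun ζ : Circle => F (r * ζ) :=
  hF.continuousOn.comp_continuous (by fun_prop) fun ζ => ofReal_mul_mem_ball h0 h1 ζ

/-- **Jensen's formula** bounds the means of `log |F|` from below, uniformly in the radius. -/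
lemma exists_le_circleAverage_log_norm {F : ℂ → ℂ}
    (hF : DifferentiableOn ℂ F (Metric.ball 0 1)) :
    ∃ c : ℝ, ∀ r : ℝ, 1 / 2 ≤ r → r < 1 → c ≤ Real.circleAverage (fun z => Real.log ‖F z‖) 0 r := by
  refine ⟨((meromorphicOrderAt F 0).untop₀ : ℝ) * Real.log (1 / 2) +
    Real.log ‖meromorphicTrailingCoeffAt F 0‖, fun r hr hr1 => ?_⟩
  have hr0 : 0 < r := by linarith
  have hsub : Metric.closedBall (0 : ℂ) |r| ⊆ Metric.ball 0 1 := by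
    rw [abs_of_pos hr0]
    exact Metric.closedBall_subset_ball hr1
  have hA : AnalyticOnNhd ℂ F (Metric.closedBall 0 |r|) :=
    (hF.analyticOnNhd Metric.isOpen_ball).mono hsub
  have hD := MeromorphicOn.AnalyticOnNhd.divisor_nonneg hA
  rw [MeromorphicOn.circleAverage_log_norm hr0.ne' hA.meromorphicOn]
  have h0 : (0 : ℂ) ∈ Metric.closedBall (0 : ℂ) |r| := by simp
  have hD0 : (0 : ℤ) ≤ (meromorphicOrderAt F 0).untop₀ := by
    rw [← MeromorphicOn.divisor_apply hA.meromorphicOn h0]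
    exact hD 0
  rw [MeromorphicOn.divisor_apply hA.meromorphicOn h0]
  have hsum : 0 ≤ ∑ᶠ u : ℂ, (MeromorphicOn.divisor F (Metric.closedBall 0 |r|) u : ℝ) *
      Real.log (r * ‖0 - u‖⁻¹) := by
    refine finsum_nonneg fun u => ?_
    by_cases hu : u ∈ Metric.closedBall (0 : ℂ) |r|
    · refine mul_nonneg (Int.cast_nonneg (hD u)) ?_
      rcases eq_or_ne u 0 with rfl | hu0
      · simp
      · refine Real.log_nonneg ?_
        rw [mem_closedBall_zero_iff, abs_of_pos hr0] at hu
        rw [zero_sub, norm_neg, ← div_eq_mul_inv, one_le_div (norm_pos_iff.2 hu0)]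
        exact hu
    · simp [Function.locallyFinsuppWithin.apply_eq_zero_of_notMem _ hu]
  have hlog : Real.log (1 / 2) ≤ Real.log r := Real.log_le_log (by norm_num) hr
  have := mul_le_mul_of_nonneg_left hlog (Int.cast_nonneg (R := ℝ) hD0)
  linarith

lemma ae_dilation_ne_zero {F : ℂ → ℂ} (hF : DifferentiableOn ℂ F (Metric.ball 0 1))
    (hne : ∃ z ∈ Metric.ball (0 : ℂ) 1, F z ≠ 0) {r : ℝ} (hr0 : 0 < r) (hr1 : r < 1) :
    ∀ᵐ ζ : Circle ∂arcLength, F (r * ζ) ≠ 0 := by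
  obtain ⟨z₀, hz₀, hFz₀⟩ := hne
  have h1 := (hF.analyticOnNhd Metric.isOpen_ball).preimage_zero_mem_codiscreteWithin hFz₀ hz₀
    ⟨⟨z₀, hz₀⟩, (convex_ball _ _).isPreconnected⟩
  have hsub : Metric.sphere (0 : ℂ) |r| ⊆ Metric.ball 0 1 := by
    rw [abs_of_pos hr0]
    exact Metric.sphere_subset_closedBall.trans (Metric.closedBall_subset_ball hr1)
  have h2 := circleMap_preimage_codiscrete hr0.ne' (codiscreteWithin_mono hsub h1)
  have h3 := ae_restrict_le_codiscreteWithin (μ := (volume : Measure ℝ)) MeasurableSet.univ h2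
  rw [Measure.restrict_univ] at h3
  have hopen : IsOpen {ζ : Circle | F (r * ζ) ≠ 0} :=
    isOpen_ne_fun (continuous_dilation hF hr0.le hr1) continuous_const
  rw [arcLength, ae_map_iff measurable_circleExp.aemeasurable hopen.measurableSet]
  refine ae_restrict_of_ae ?_
  filter_upwards [h3] with θ hθ
  simpa [circleMap] using hθ

lemma exists_lintegral_logMinus_le {F : ℂ → ℂ} (hF : DifferentiableOn ℂ F (Metric.ball 0 1))
    (hne : ∃ z ∈ Metric.ball (0 : ℂ) 1, F z ≠ 0) {B : ℝ}
    (hB : ∀ z ∈ Metric.ball (0 : ℂ) 1, ‖F z‖ ≤ B) :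
    ∃ C : ℝ, ∀ r : ℝ, 1 / 2 ≤ r → r < 1 →
      ∫⁻ ζ : Circle, logMinus ‖F (r * ζ)‖ ∂arcLength ≤ ENNReal.ofReal C := by
  obtain ⟨c, hc⟩ := exists_le_circleAverage_log_norm hF
  set b := Real.log (max B 1) with hb
  have hb0 : 0 ≤ b := Real.log_nonneg (le_max_right _ _)
  refine ⟨2 * Real.pi * (b - c), fun r hr hr1 => ?_⟩
  have hr0 : 0 < r := by linarith
  have hcont := continuous_dilation hF hr0.le hr1
  have hmeas : Measurable fun ζ : Circle => Real.log ‖F (r * ζ)‖ :=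
    Real.measurable_log.comp hcont.norm.measurable
  have hae := ae_dilation_ne_zero hF hne hr0 hr1
  have hlogle : ∀ᵐ ζ : Circle ∂arcLength, Real.log ‖F (r * ζ)‖ ≤ b := by
    filter_upwards [hae] with ζ hζ
    exact Real.log_le_log (norm_pos_iff.2 hζ)
      ((hB _ (ofReal_mul_mem_ball hr0.le hr1 ζ)).trans (le_max_left _ _))
  have hsub : Metric.sphere (0 : ℂ) |r| ⊆ Metric.ball 0 1 := by
    rw [abs_of_pos hr0]
    exact Metric.sphere_subset_closedBall.trans (Metric.closedBall_subset_ball hr1)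
  have hCI : CircleIntegrable (fun z : ℂ => Real.log ‖F (r * z)‖) 0 1 := by
    have := MeromorphicOn.circleIntegrable_log_norm (c := 0) (R := r)
      ((hF.analyticOnNhd Metric.isOpen_ball).mono hsub).meromorphicOn
    simpa [CircleIntegrable, circleMap] using this
  have hint := integrable_arcLength hmeas.aestronglyMeasurable hCI
  have havg : Real.circleAverage (fun z => Real.log ‖F z‖) 0 r =
      (2 * Real.pi)⁻¹ • ∫ ζ : Circle, Real.log ‖F (r * ζ)‖ ∂arcLength := by
    rw [← circleAverage_eq_integral_arcLength (F := fun z => Real.log ‖F (r * z)‖)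
      hmeas.aestronglyMeasurable, Real.circleAverage_def, Real.circleAverage_def]
    simp [circleMap]
  have htot : ∫ _ : Circle, b ∂arcLength = 2 * Real.pi * b := by
    have h1 := circleAverage_eq_integral_arcLength (F := fun _ => b)
      (by fun_prop)
    rw [Real.circleAverage_const, smul_eq_mul] at h1
    rw [inv_mul_eq_div, eq_div_iff (by positivity)] at h1
    linarith
  calc ∫⁻ ζ : Circle, logMinus ‖F (r * ζ)‖ ∂arcLength
      ≤ ∫⁻ ζ : Circle, ENNReal.ofReal (b - Real.log ‖F (r * ζ)‖) ∂arcLength := by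
        refine lintegral_mono_ae ?_
        filter_upwards [hae] with ζ hζ
        rw [logMinus_of_pos (norm_pos_iff.2 hζ)]
        exact ENNReal.ofReal_le_ofReal (by linarith)
    _ = ENNReal.ofReal (∫ ζ : Circle, (b - Real.log ‖F (r * ζ)‖) ∂arcLength) := by
        refine (ofReal_integral_eq_lintegral_ofReal ((integrable_const b).sub hint) ?_).symm
        filter_upwards [hlogle] with ζ hζ using sub_nonneg.2 hζ
    _ ≤ ENNReal.ofReal (2 * Real.pi * (b - c)) := by
        refine ENNReal.ofReal_le_ofReal ?_
        rw [integral_sub (integrable_const b) hint, htot]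
        have h1 := hc r hr hr1
        rw [havg, smul_eq_mul, inv_mul_eq_div, le_div_iff₀ (by positivity)] at h1
        linarith

/-- A boundary trace is, in particular, a radial limit. -/
lemma IsBoundaryTrace.tendsto_radial {F : ℂ → ℂ} {f : Circle → ℂ} (h : IsBoundaryTrace F f)
    {r : ℕ → ℝ} (hr0 : ∀ n, 0 ≤ r n) (hr1 : ∀ n, r n < 1) (hr : Tendsto r atTop (𝓝 1)) :
    ∀ᵐ ζ : Circle ∂arcLength, Tendsto (fun n => F (r n * ζ)) atTop (𝓝 (f ζ)) := by
  filter_upwards [h] with ζ hζ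
  refine (hζ 2 one_lt_two).comp (tendsto_nhdsWithin_iff.2 ⟨?_, .of_forall fun n => ?_⟩)
  · have h1 : Tendsto (fun n => (r n : ℂ) * ζ) atTop (𝓝 (((1 : ℝ) : ℂ) * ζ)) :=
      ((Complex.continuous_ofReal.tendsto 1).comp hr).mul_const _
    simpa using h1
  · have h1 : ‖(r n : ℂ) * ζ‖ = r n := by
      simp [abs_of_nonneg (hr0 n), Circle.norm_coe]
    refine ⟨h1.trans_lt (hr1 n), ?_⟩
    rw [h1, show (r n : ℂ) * ζ - ζ = ((r n - 1 : ℝ) : ℂ) * ζ by push_cast; ring, norm_mul,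
      Complex.norm_real, Circle.norm_coe, mul_one, Real.norm_eq_abs, abs_sub_comm,
      abs_of_nonneg (by linarith [hr1 n])]
    linarith [hr1 n]

/-- A nonzero `H^∞` function has an integrable logarithm on the circle: the Jensen bound passes to
the boundary by Fatou's lemma. -/
theorem lintegral_logMinus_norm_ne_top {h : C(Circle, ℂ)} (hh : MemHInfty h) (h0 : h ≠ 0) :
    ∫⁻ ζ, logMinus ‖h ζ‖ ∂arcLength ≠ ⊤ := by
  obtain ⟨F, hF, ⟨B, hB⟩, htr⟩ := hh
  set r : ℕ → ℝ := fun n => 1 - 1 / 2 * (1 / ((n : ℝ) + 1)) with hr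
  have hn : ∀ n : ℕ, 0 < 1 / ((n : ℝ) + 1) ∧ 1 / ((n : ℝ) + 1) ≤ 1 := fun n =>
    ⟨by positivity, by
      rw [div_le_one (by positivity)]
      linarith [n.cast_nonneg (α := ℝ)]⟩
  have hrhalf : ∀ n, 1 / 2 ≤ r n := fun n => by
    have := (hn n).2
    simp only [hr]
    linarith
  have hr1 : ∀ n, r n < 1 := fun n => by
    have := (hn n).1
    simp only [hr]
    linarith
  have hlim : Tendsto r atTop (𝓝 1) := by
    have := (tendsto_one_div_add_atTop_nhds_zero_nat (𝕜 := ℝ)).const_mul (1 / 2)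
    simpa [hr] using this.const_sub 1
  have hr0 : ∀ n, 0 ≤ r n := fun n => by linarith [hrhalf n]
  have hrad := htr.tendsto_radial hr0 hr1 hlim
  have hne : ∃ z ∈ Metric.ball (0 : ℂ) 1, F z ≠ 0 := by
    by_contra! hzero
    refine h0 (eq_zero_of_ae_eq_zero ?_)
    filter_upwards [hrad] with ζ hζ
    refine tendsto_nhds_unique hζ ?_
    simp only [fun n => hzero _ (ofReal_mul_mem_ball (hr0 n) (hr1 n) ζ)]
    exact tendsto_const_nhds
  obtain ⟨C, hC⟩ := exists_lintegral_logMinus_le hF hne hB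
  refine ne_top_of_le_ne_top (ENNReal.ofReal_ne_top (r := C)) ?_
  calc ∫⁻ ζ, logMinus ‖h ζ‖ ∂arcLength
      = ∫⁻ ζ : Circle, liminf (fun n => logMinus ‖F (r n * ζ)‖) atTop ∂arcLength := by
        refine lintegral_congr_ae ?_
        filter_upwards [hrad] with ζ hζ
        exact ((continuous_logMinus.tendsto _).comp hζ.norm).liminf_eq.symm
    _ ≤ liminf (fun n => ∫⁻ ζ : Circle, logMinus ‖F (r n * ζ)‖ ∂arcLength) atTop :=
        lintegral_liminf_le fun n => (continuous_logMinus.comp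
          (continuous_dilation hF (hr0 n) (hr1 n)).norm).measurable
    _ ≤ liminf (fun _ : ℕ => ENNReal.ofReal C) atTop :=
        liminf_le_liminf (.of_forall fun n => hC _ (hrhalf n) (hr1 n))
    _ = ENNReal.ofReal C := liminf_const _

/-! ### The unit ball of `C_A(Λ)` -/

variable {Λ : Set ℕ}

lemma mem_closedBall_CA_iff {f : CA Λ} :
    f ∈ Metric.closedBall (0 : CA Λ) 1 ↔ ∀ ζ, ‖(f : C(Circle, ℂ)) ζ‖ ≤ 1 := by
  rw [mem_closedBall_zero_iff, Submodule.coe_norm, ContinuousMap.norm_le _ zero_le_one]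

/-- Multiplication by `z ^ N` moves the spectrum of a disk algebra function into `[N, ∞)`. -/
lemma exists_CA_eq_pow_mul {g : ℂ → ℂ} (hgc : ContinuousOn g (Metric.closedBall 0 1))
    (hgd : DifferentiableOn ℂ g (Metric.ball 0 1)) {N : ℕ} (hN : ∀ n, N ≤ n → n ∈ Λ) :
    ∃ h : CA Λ, ∀ ζ : Circle, (h : C(Circle, ℂ)) ζ = (ζ : ℂ) ^ N * g ζ := by
  have hcl : ∀ ζ : Circle, (ζ : ℂ) ∈ Metric.closedBall (0 : ℂ) 1 := fun ζ => by
    simp [Circle.norm_coe]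
  have hGc : ContinuousOn (fun z : ℂ => z ^ N * g z) (Metric.closedBall 0 1) := by fun_prop
  have hGd : DifferentiableOn ℂ (fun z : ℂ => z ^ N * g z) (Metric.ball 0 1) := by fun_prop
  refine ⟨⟨⟨fun ζ : Circle => (ζ : ℂ) ^ N * g ζ, hGc.comp_continuous (by fun_prop) hcl⟩,
    ⟨⟨fun z => z ^ N * g z, hGd, ?_, ?_⟩, ?_⟩⟩, fun ζ => rfl⟩
  · obtain ⟨C, hC⟩ := (isCompact_closedBall (0 : ℂ) 1).exists_bound_of_continuousOn hGc
    exact ⟨C, fun z hz => hC z (Metric.ball_subset_closedBall hz)⟩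
  · refine ae_of_all _ fun ζ α _ => (hGc ζ (hcl ζ)).mono_left (nhdsWithin_mono _ fun z hz => ?_)
    rw [mem_closedBall_zero_iff]
    exact hz.1.le
  · intro k hk
    by_contra hkΛ
    refine hk ?_
    -- Only exponents below `N` can lie outside `Λ`.
    have hkN : k < N := by
      by_contra! h
      obtain ⟨n, rfl⟩ := Int.eq_ofNat_of_zero_le ((Int.natCast_nonneg N).trans h)
      exact hkΛ ⟨n, hN n (by exact_mod_cast h), rfl⟩
    obtain ⟨m, hm⟩ : ∃ m : ℕ, (N : ℤ) = k + (m + 1) := ⟨(N - k - 1).toNat, by omega⟩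
    have hD : DiffContOnCl ℂ (fun z : ℂ => z ^ (m + 1) * g z) (Metric.ball 0 |1|) := by
      rw [abs_one]
      refine ⟨by fun_prop, ?_⟩
      rw [closure_ball _ one_ne_zero]
      fun_prop
    have hcont : Continuous fun ζ : Circle => (ζ : ℂ) ^ (m + 1) * g ζ :=
      hD.continuousOn_ball.comp_continuous (by fun_prop) (by simpa using hcl)
    have hzero := hD.circleAverage
    rw [circleAverage_eq_integral_arcLength
      hcont.measurable.aestronglyMeasurable] at hzero
    have hpt : ∀ ζ : Circle, conj (ζ : ℂ) ^ k * ((ζ : ℂ) ^ N * g ζ) =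
        (ζ : ℂ) ^ (m + 1) * g ζ := fun ζ => by
      rw [← Circle.coe_inv_eq_conj, Circle.coe_inv, ← zpow_natCast _ N, hm, ← mul_assoc, inv_zpow,
        zpow_add₀ (Circle.coe_ne_zero ζ), inv_mul_cancel_left₀
          (zpow_ne_zero _ (Circle.coe_ne_zero ζ))]
      norm_cast
    have hint : ∫ ζ : Circle, (ζ : ℂ) ^ (m + 1) * g ζ ∂arcLength = 0 := by
      simpa [Real.pi_ne_zero] using hzero
    simp only [fourierCoefficient, ContinuousMap.coe_mk, hpt, hint, mul_zero]

/-- If `∫ log (1 - |f|) > -∞`, the unit ball contains a nontrivial segment centred at `f`. -/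
lemma exists_ne_zero_norm_add_norm_le_one (hΛ : Λᶜ.Finite) {f : C(Circle, ℂ)}
    (hf : ∀ ζ, ‖f ζ‖ ≤ 1) (hlog : ∫⁻ ζ, logMinus (1 - ‖f ζ‖) ∂arcLength ≠ ⊤) :
    ∃ h : CA Λ, h ≠ 0 ∧ ∀ ζ, ‖f ζ‖ + ‖(h : C(Circle, ℂ)) ζ‖ ≤ 1 := by
  have hemb : IsClosedEmbedding fun ζ : Circle => (ζ : ℂ) :=
    Continuous.isClosedEmbedding (by fun_prop) fun _ _ => Circle.ext
  obtain ⟨φ, hφmem, hφ⟩ :=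
    BoundedContinuousFunction.exists_extension_forall_mem_Icc_of_isClosedEmbedding
    (BoundedContinuousFunction.mkOfCompact ⟨fun ζ => 1 - ‖f ζ‖, by fun_prop⟩)
    (a := 0) (b := 1) (e := fun ζ : Circle => (ζ : ℂ))
    (fun ζ => ⟨by simpa using hf ζ, by simp⟩) zero_le_one hemb
  have hφζ : ∀ ζ : Circle, φ ζ = 1 - ‖f ζ‖ := fun ζ => congrFun hφ ζ
  have hle : ∀ N ζ, ENNReal.ofReal (negLogTrunc φ N ζ) ≤ logMinus (φ ζ) := by
    intro N ζ
    rcases (hφmem ζ).1.eq_or_lt with h | h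
    · rw [← h, logMinus_of_nonpos le_rfl]
      exact le_top
    · rw [logMinus_of_pos h]
      exact ENNReal.ofReal_le_ofReal (neg_le_neg (Real.log_le_log h (le_max_left _ _)))
  have hnonneg : ∀ N z, 0 ≤ negLogTrunc φ N z := fun N z =>
    neg_nonneg.2 (Real.log_nonpos ((hφmem z).1.trans (le_max_left _ _))
      (max_le (hφmem z).2 (by simp)))
  have hI : ∀ N, Real.circleAverage (negLogTrunc φ N) 0 1 ≤
      (2 * Real.pi)⁻¹ * (∫⁻ ζ, logMinus (1 - ‖f ζ‖) ∂arcLength).toReal := by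
    intro N
    have hc : Continuous fun ζ : Circle => negLogTrunc φ N ζ :=
      (continuous_negLogTrunc φ.continuous N).comp (by fun_prop)
    rw [circleAverage_eq_integral_arcLength hc.measurable.aestronglyMeasurable, smul_eq_mul]
    refine mul_le_mul_of_nonneg_left ?_ (by positivity)
    rw [integral_eq_lintegral_of_nonneg_ae (f := fun ζ : Circle => negLogTrunc φ N ζ)
      (ae_of_all _ fun ζ => hnonneg N ζ)
      hc.measurable.aestronglyMeasurable]
    refine ENNReal.toReal_mono hlog (lintegral_mono fun ζ => ?_)
    rw [← hφζ]
    exact hle N ζ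
  obtain ⟨g, hgc, hgd, hg0, hg⟩ := exists_diskAlgebra_norm_le φ.continuous
    (fun z => (hφmem z).1) (fun z => (hφmem z).2) hI
  obtain ⟨M, hM⟩ := hΛ.bddAbove
  obtain ⟨h, hh⟩ := exists_CA_eq_pow_mul (Λ := Λ) (N := M + 1) hgc hgd fun n hn => by
    by_contra hnΛ
    have := hM hnΛ
    omega
  refine ⟨(Real.exp (-2) : ℂ) • h, fun hzero => hg0 ?_, fun ζ => ?_⟩
  · -- A disk algebra function vanishing on the circle vanishes at the centre.
    have hh0 : h = 0 := (smul_eq_zero.1 hzero).resolve_left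
      (by exact_mod_cast (Real.exp_pos _).ne')
    have hD : DiffContOnCl ℂ g (Metric.ball 0 |1|) := by
      rw [abs_one]
      exact ⟨hgd, by rwa [closure_ball _ one_ne_zero]⟩
    rw [← hD.circleAverage, Real.circleAverage_congr_sphere (f₂ := fun _ => (0 : ℂ)),
      Real.circleAverage_const]
    intro z hz
    rw [abs_one] at hz
    obtain ⟨ζ, rfl⟩ : ∃ ζ : Circle, (ζ : ℂ) = z := ⟨⟨z, hz⟩, rfl⟩
    have h1 := hh ζ
    rw [hh0, ZeroMemClass.coe_zero, ContinuousMap.zero_apply] at h1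
    exact (mul_eq_zero.1 h1.symm).resolve_left (pow_ne_zero _ ζ.coe_ne_zero)
  · have h1 := hg ζ (by simp [Circle.norm_coe])
    have h2 : Real.exp (-2) * Real.exp 2 = 1 := by rw [← Real.exp_add]; simp
    have h3 : ‖(((Real.exp (-2) : ℂ) • h : CA Λ) : C(Circle, ℂ)) ζ‖ =
        Real.exp (-2) * ‖g ζ‖ := by
      rw [Submodule.coe_smul, ContinuousMap.smul_apply, hh, norm_smul, norm_mul, norm_pow,
        Circle.norm_coe, one_pow, one_mul, Complex.norm_real,
        Real.norm_of_nonneg (Real.exp_pos _).le]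
    have h4 : Real.exp (-2) * ‖g ζ‖ ≤ φ ζ :=
      (mul_le_mul_of_nonneg_left h1 (Real.exp_pos _).le).trans_eq
        (by rw [← mul_assoc, h2, one_mul])
    rw [h3]
    linarith [hφζ ζ]

/-- A convex combination of two distinct points `x`, `y` of the unit ball loses a multiple of
`|x - y|²` in modulus, whose logarithm is integrable. -/
lemma lintegral_logMinus_one_sub_norm_ne_top {x y : CA Λ} (hxy : x ≠ y)
    (hx : ∀ ζ, ‖(x : C(Circle, ℂ)) ζ‖ ≤ 1) (hy : ∀ ζ, ‖(y : C(Circle, ℂ)) ζ‖ ≤ 1)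
    {a b : ℝ} (ha : 0 < a) (hb : 0 < b) (hab : a + b = 1) :
    ∫⁻ ζ, logMinus (1 - ‖((a • x + b • y : CA Λ) : C(Circle, ℂ)) ζ‖) ∂arcLength ≠ ⊤ := by
  set h : CA Λ := x - y with hh
  have hne : (h : C(Circle, ℂ)) ≠ 0 := by
    simpa [hh, sub_eq_zero] using hxy
  have hfin := lintegral_logMinus_norm_ne_top h.2.1 hne
  set k := a * b / 2 with hk
  have hk0 : 0 < k := by positivity
  have hpt : ∀ ζ, logMinus (1 - ‖((a • x + b • y : CA Λ) : C(Circle, ℂ)) ζ‖) ≤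
      logMinus k + 2 * logMinus ‖(h : C(Circle, ℂ)) ζ‖ := by
    intro ζ
    set u := (x : C(Circle, ℂ)) ζ
    set v := (y : C(Circle, ℂ)) ζ
    have hcomb : ((a • x + b • y : CA Λ) : C(Circle, ℂ)) ζ = a * u + b * v := by
      simp [u, v]
    have hdiff : (h : C(Circle, ℂ)) ζ = u - v := by simp [hh, u, v]
    rw [hcomb, hdiff]
    have hu : ‖u‖ ^ 2 ≤ 1 := pow_le_one₀ (norm_nonneg _) (hx ζ)
    have hv : ‖v‖ ^ 2 ≤ 1 := pow_le_one₀ (norm_nonneg _) (hy ζ)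
    have hid : ‖(a : ℂ) * u + b * v‖ ^ 2 + a * b * ‖u - v‖ ^ 2 =
        a * ‖u‖ ^ 2 + b * ‖v‖ ^ 2 := by
      obtain rfl : b = 1 - a := by linarith
      simp only [← Complex.normSq_eq_norm_sq, Complex.normSq_apply, Complex.add_re, Complex.add_im,
        Complex.sub_re, Complex.sub_im, Complex.re_ofReal_mul, Complex.im_ofReal_mul]
      ring
    have h1 : k * (‖u - v‖ * ‖u - v‖) ≤ 1 - ‖(a : ℂ) * u + b * v‖ := by
      have h2 : ‖(a : ℂ) * u + b * v‖ ^ 2 + a * b * ‖u - v‖ ^ 2 ≤ 1 := by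
        rw [hid]
        nlinarith
      have h3 : 0 ≤ a * b * ‖u - v‖ ^ 2 := by positivity
      have h4 : ‖(a : ℂ) * u + b * v‖ ≤ 1 := by nlinarith [norm_nonneg ((a : ℂ) * u + b * v)]
      rw [hk]
      nlinarith [norm_nonneg ((a : ℂ) * u + b * v)]
    refine (antitone_logMinus h1).trans ((logMinus_mul_le hk0).trans (add_le_add le_rfl ?_))
    rcases (norm_nonneg (u - v)).eq_or_lt with h0 | h0
    · rw [← h0, logMinus_of_nonpos le_rfl, ENNReal.mul_top two_ne_zero]
      exact le_top
    · rw [two_mul]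
      exact logMinus_mul_le h0
  refine ne_top_of_le_ne_top ?_ (lintegral_mono hpt)
  rw [lintegral_add_left measurable_const, lintegral_const, lintegral_const_mul' _ _ (by simp),
    logMinus_of_pos hk0]
  exact ENNReal.add_ne_top.2 ⟨ENNReal.mul_ne_top ENNReal.ofReal_ne_top (measure_ne_top _ _),
    ENNReal.mul_ne_top (by simp) hfin⟩

lemma norm_eq_one_of_lintegral_logMinus_eq_top {f : C(Circle, ℂ)} (hf : ‖f‖ ≤ 1)
    (htop : ∫⁻ ζ, logMinus (1 - ‖f ζ‖) ∂arcLength = ⊤) : ‖f‖ = 1 := by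
  by_contra hne
  have hpos : 0 < 1 - ‖f‖ := sub_pos.2 (lt_of_le_of_ne hf hne)
  have hle : ∀ ζ, logMinus (1 - ‖f ζ‖) ≤ logMinus (1 - ‖f‖) := fun ζ =>
    antitone_logMinus (by linarith [f.norm_coe_le_norm ζ])
  refine ne_top_of_le_ne_top ?_ (lintegral_mono hle) htop
  rw [lintegral_const, logMinus_of_pos hpos]
  exact ENNReal.mul_ne_top ENNReal.ofReal_ne_top (measure_ne_top _ _)

end DiskAlgebra

theorem proposition2p2 (Λ : Set ℕ) (hΛ : Λᶜ.Finite) :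
    (Metric.closedBall (0 : DiskAlgebra.CA Λ) 1).extremePoints ℝ =
      {f : DiskAlgebra.CA Λ | ‖f‖ = 1 ∧ DiskAlgebra.logIntegral (f : C(Circle, ℂ)) = ⊥} := by
  ext f
  rw [mem_extremePoints, mem_ofPred_eq, DiskAlgebra.logIntegral_eq_bot_iff]
  constructor
  · rintro ⟨hf, hext⟩
    have hf1 := DiskAlgebra.mem_closedBall_CA_iff.1 hf
    have htop : ∫⁻ ζ, DiskAlgebra.logMinus (1 - ‖(f : C(Circle, ℂ)) ζ‖)
        ∂DiskAlgebra.arcLength = ⊤ := by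
      by_contra hlog
      obtain ⟨h, h0, hle⟩ := DiskAlgebra.exists_ne_zero_norm_add_norm_le_one hΛ hf1 hlog
      have hadd : f + h ∈ Metric.closedBall (0 : DiskAlgebra.CA Λ) 1 :=
        DiskAlgebra.mem_closedBall_CA_iff.2 fun ζ => (norm_add_le _ _).trans (hle ζ)
      have hsub : f - h ∈ Metric.closedBall (0 : DiskAlgebra.CA Λ) 1 :=
        DiskAlgebra.mem_closedBall_CA_iff.2 fun ζ => (norm_sub_le _ _).trans (hle ζ)
      have hseg : f ∈ openSegment ℝ (f + h) (f - h) := by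
        refine ⟨1 / 2, 1 / 2, by norm_num, by norm_num, by norm_num, ?_⟩
        rw [← smul_add, add_add_sub_cancel, ← two_smul ℝ f, smul_smul]
        norm_num
      exact h0 (add_eq_left.1 (hext _ hadd _ hsub hseg).1)
    exact ⟨DiskAlgebra.norm_eq_one_of_lintegral_logMinus_eq_top
      (mem_closedBall_zero_iff.1 hf) htop, htop⟩
  · rintro ⟨hf, htop⟩
    refine ⟨mem_closedBall_zero_iff.2 hf.le, fun x hx y hy hseg => ?_⟩
    obtain ⟨a, b, ha, hb, hab, rfl⟩ := hseg
    obtain rfl : x = y := by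
      by_contra hxy
      exact DiskAlgebra.lintegral_logMinus_one_sub_norm_ne_top hxy
        (DiskAlgebra.mem_closedBall_CA_iff.1 hx) (DiskAlgebra.mem_closedBall_CA_iff.1 hy)
        ha hb hab htop
    rw [← add_smul, hab, one_smul]
    exact ⟨rfl, rfl⟩
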